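/- For $m\ge 1$ let $D$ be the $m\times m$ difference matrix, $D_{ii}=1$, $D_{i+1,i}=-1$ and all other entries $0$. Write $\sigma_j(A)$ for the $j$-th largest singular value of a real matrix $A$, and $\sigma_{\min}(A)=\sigma_n(A)$ for the smallest one when $A$ has $n$ columns (the square root of the smallest eigenvalue of $A^{T}A$). Let $r\ge 1$ be an integer. There are constants $c_1,c_6,c_7>0$, depending only on $r$, such that $$\sigma_j(D^{-r})\ \ge\ c_1\Big(\frac mj\Big)^{r}\qquad\text{for all } 1\le j\le m,$$ and such that the following holds. Let $0<\alpha<1$, let $m\ge 1$ and $1\le k\le N$ be integers with $$\lambda:=\frac mk\ \ge\ c_6(\log N)^{1/(1-\alpha)},$$ and let $\Phi$ be an $m\times N$ random matrix whose entries are i.i.d. $\mathcal N(0,\frac1m)$. Then, with probability at least $1-2e^{-c_7 m\lambda^{-\alpha}}$, every $m\times k$ submatrix $E$ of $\Phi$ (formed by $k$ distinct columns of $\Phi$) satisfies $$\sigma_{\min}(D^{-r}E)\ \ge\ c_1\,\lambda^{\alpha(r-\frac12)}.$$ -/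

import Mathlib

open MeasureTheory ProbabilityTheory
open scoped NNReal

namespace SigmaDelta

/-- The `m × m` difference matrix: `1` on the diagonal, `-1` on the first subdiagonal. -/
def diffMatrix (m : ℕ) : Matrix (Fin m) (Fin m) ℝ :=
  Matrix.of fun i j => if i = j then 1 else if (i : ℕ) = (j : ℕ) + 1 then -1 else 0

/-- The difference matrix is invertible, so that its matrix inverse is the genuine one. -/
theorem det_diffMatrix (m : ℕ) : (diffMatrix m).det = 1 := by
  rw [Matrix.det_of_isLowerTriangular]
  · simp [diffMatrix]
  · intro i j hij
    have h : i < j := hij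
    have h1 : i ≠ j := h.ne
    have h2 : ¬ (i : ℕ) = (j : ℕ) + 1 := by
      have : (i : ℕ) < j := h
      omega
    simp [diffMatrix, h1, h2]

/-- `D^{-r}`, where `D` is the difference matrix. -/
noncomputable def invDiffPow (m r : ℕ) : Matrix (Fin m) (Fin m) ℝ :=
  (diffMatrix m)⁻¹ ^ r

/-- `σ_j(A)`, the `j`-th largest singular value of a real matrix with respect to the Euclidean
norms, for `1 ≤ j ≤ n` (Mathlib counts the singular values from `0`). -/
noncomputable def singVal {m n : ℕ} (A : Matrix (Fin m) (Fin n) ℝ) (j : ℕ) : ℝ :=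
  (Matrix.toEuclideanLin A).singularValues (j - 1)

/-- `σ_min(A)`, the smallest of the `n` singular values of an `m × n` matrix, `1 ≤ n`
(the square root of the smallest eigenvalue of `Aᵀ A`). -/
noncomputable def singMin {m n : ℕ} (A : Matrix (Fin m) (Fin n) ℝ) : ℝ :=
  singVal A n

/-- `Φ` is a random `m × N` matrix on `(Ω, P)` with i.i.d. entries of law `𝒩(0, 1/m)`. -/
structure IsGaussianMatrix {Ω : Type*} [MeasurableSpace Ω] (P : Measure Ω) {m N : ℕ}
    (Φ : Ω → Matrix (Fin m) (Fin N) ℝ) : Prop where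
  law : ∀ i j, HasLaw (fun ω => Φ ω i j) (gaussianReal 0 (1 / (m : ℝ≥0))) P
  indep : iIndepFun (fun (p : Fin m × Fin N) (ω : Ω) => Φ ω p.1 p.2) P

end SigmaDelta

/-! Write `H` for $D^{-r}$. The proof separates a deterministic lower bound for the singular values
of `H` from a Gaussian estimate in dimension `l`, the integer part of
$m\lambda^{-\alpha}=k\lambda^{1-\alpha}$.

Deterministic part (`const_mul_le_singVal_invDiffPow`): by the max-min principle it suffices to find
a `j`-dimensional space of vectors $y$ with $\|D^r y\|$ small against $\|y\|$. Since `D` is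
multiplication by $1-X$ modulo $X^m$, one takes combinations of `j` disjoint translates of the
smooth bump $(1+X+\dots+X^{w-1})^{r+1}$, with $w$ of order $m/j$; each difference costs a factor of
order $1/w$.

Random part (`prob_singMin_mul_submatrix_ge`): $\|Hx\|\ge\sigma_l(H)\|Bx\|$, where `B` projects onto
the top `l` right singular vectors. The matrix $B\Phi$ is again Gaussian, now with `l` rows, and `l`
is at least of order $k\log N$. A small-ball estimate, a bound on column norms and a grid of mesh of
order $1/k$ show that every $BE$ has least singular value at least of order $\sqrt{l/m}$.

Together this gives $\sigma_l(H)\sqrt{l/m}\gtrsim(m/l)^{r-1/2}\ge\lambda^{\alpha(r-1/2)}$. -/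

namespace SigmaDelta

/-! ### Variational bounds for singular values. -/

section SingularValues

open Module

variable {E F : Type*} [NormedAddCommGroup E] [InnerProductSpace ℝ E] [FiniteDimensional ℝ E]
  [NormedAddCommGroup F] [InnerProductSpace ℝ F] [FiniteDimensional ℝ F]

/-- In a basis of right singular vectors, `‖T x‖²` is a weighted sum of squared coordinates. -/
theorem norm_sq_apply_eq_sum_singularValues (T : E →ₗ[ℝ] F) (x : E) :
    ‖T x‖ ^ 2 = ∑ i : Fin (finrank ℝ E), T.singularValues i ^ 2 *
      (T.isSymmetric_adjoint_comp_self.eigenvectorBasis rfl).repr x i ^ 2 := by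
  set b := T.isSymmetric_adjoint_comp_self.eigenvectorBasis rfl with hb
  have h1 : ‖T x‖ ^ 2 = inner ℝ ((LinearMap.adjoint T ∘ₗ T) x) x := by
    rw [LinearMap.comp_apply, LinearMap.adjoint_inner_left, real_inner_self_eq_norm_sq]
  rw [h1, ← b.repr.inner_map_map, PiLp.inner_apply]
  refine Finset.sum_congr rfl fun i _ => ?_
  have h2 := T.isSymmetric_adjoint_comp_self.eigenvectorBasis_apply_self_apply rfl x i
  rw [← hb] at h2
  rw [h2, T.sq_singularValues_fin rfl]
  simp
  ring

/-- One half of Courant–Fischer: as `V` has dimension greater than `i`, some nonzero vector of the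
range of `L` is orthogonal to the first `i` right singular vectors, and `T` stretches it by at most
the singular value of index `i`. -/
theorem le_singularValues_of_injective {V : Type*} [AddCommGroup V] [Module ℝ V]
    [FiniteDimensional ℝ V] (T : E →ₗ[ℝ] F) (L : V →ₗ[ℝ] E) (hL : Function.Injective L)
    {i : ℕ} (hi : i < finrank ℝ V) {t : ℝ} (h : ∀ a, t * ‖L a‖ ≤ ‖T (L a)‖) :
    t ≤ T.singularValues i := by
  set b := T.isSymmetric_adjoint_comp_self.eigenvectorBasis rfl with hb
  have hiE : i < finrank ℝ E := hi.trans_le (LinearMap.finrank_le_finrank_of_injective hL)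
  let C : V →ₗ[ℝ] (Fin i → ℝ) :=
    LinearMap.pi fun k => (innerₛₗ ℝ (b (Fin.castLE hiE.le k))) ∘ₗ L
  have hker : LinearMap.ker C ≠ ⊥ := LinearMap.ker_ne_bot_of_finrank_lt (by simpa using hi)
  obtain ⟨a, ha, ha0⟩ := Submodule.exists_mem_ne_zero_of_ne_bot hker
  have hLa : 0 < ‖L a‖ := norm_pos_iff.2 fun h0 => ha0 (hL (by simpa using h0))
  have hcoord : ∀ k : Fin (finrank ℝ E), (k : ℕ) < i → b.repr (L a) k = 0 := by
    intro k hk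
    have := congrFun (LinearMap.mem_ker.1 ha) ⟨k, hk⟩
    rw [b.repr_apply_apply]
    simpa [C] using this
  have hle : ‖T (L a)‖ ^ 2 ≤ (T.singularValues i * ‖L a‖) ^ 2 := by
    rw [norm_sq_apply_eq_sum_singularValues, mul_pow, ← b.repr.norm_map (L a),
      EuclideanSpace.norm_sq_eq, Finset.mul_sum]
    refine Finset.sum_le_sum fun k _ => ?_
    rw [Real.norm_eq_abs, sq_abs, ← hb]
    rcases lt_or_ge (k : ℕ) i with hk | hk
    · simp [hcoord k hk]
    · gcongr
      · exact T.singularValues_nonneg _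
      · exact T.singularValues_antitone hk
  have hle' := le_of_sq_le_sq hle (mul_nonneg (T.singularValues_nonneg _) hLa.le)
  exact le_of_mul_le_mul_right ((h a).trans hle') hLa

/-- `B` consists of the top `l` right singular vectors; the rest of the expansion of `‖T x‖ ^ 2` is
discarded. -/
theorem exists_orthonormal_singularValues_le (T : E →ₗ[ℝ] F) {l : ℕ} (hl : l ≤ finrank ℝ E) :
    ∃ B : Fin l → E, Orthonormal ℝ B ∧
      ∀ x, T.singularValues (l - 1) ^ 2 * ∑ a, inner ℝ (B a) x ^ 2 ≤ ‖T x‖ ^ 2 := by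
  set b := T.isSymmetric_adjoint_comp_self.eigenvectorBasis rfl with hb
  refine ⟨fun a => b (Fin.castLE hl a),
    b.orthonormal.comp _ (Fin.castLE_injective hl), fun x => ?_⟩
  rw [norm_sq_apply_eq_sum_singularValues, Finset.mul_sum, ← hb]
  calc ∑ a : Fin l, T.singularValues (l - 1) ^ 2 * inner ℝ (b (Fin.castLE hl a)) x ^ 2
      ≤ ∑ a : Fin l, T.singularValues (Fin.castLE hl a) ^ 2 *
          b.repr x (Fin.castLE hl a) ^ 2 := by
        refine Finset.sum_le_sum fun a _ => ?_
        rw [b.repr_apply_apply]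
        gcongr
        · exact T.singularValues_nonneg _
        · apply T.singularValues_antitone
          have := a.2
          simp only [Fin.val_castLE]
          omega
    _ = ∑ k ∈ Finset.univ.map (Fin.castLEEmb hl), T.singularValues k ^ 2 * b.repr x k ^ 2 := by
        rw [Finset.sum_map]; rfl
    _ ≤ _ := Finset.sum_le_sum_of_subset_of_nonneg (Finset.subset_univ _)
        fun _ _ _ => by positivity

end SingularValues

/-! ### Singular values of the inverse difference operator, via polynomials. -/

section InvDiffPow

open Polynomial

/-- The first `m` coefficients of a polynomial. -/
def coeffVec (m : ℕ) (p : ℝ[X]) : Fin m → ℝ := fun n => p.coeff n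

theorem diffMatrix_mulVec_coeffVec (m : ℕ) (p : ℝ[X]) :
    (diffMatrix m).mulVec (coeffVec m p) = coeffVec m ((1 - X) * p) := by
  ext ⟨i, hi⟩
  have hX : ((1 - X) * p).coeff i = p.coeff i - (X * p).coeff i := by
    rw [sub_mul, one_mul, coeff_sub]
  simp only [Matrix.mulVec, dotProduct, coeffVec, hX, diffMatrix, Matrix.of_apply]
  rcases i with _ | i
  · rw [Finset.sum_eq_single ⟨0, hi⟩]
    · simp
    · intro b _ hb
      rw [if_neg (Ne.symm hb), if_neg (by simp), zero_mul]
    · simp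
  · rw [coeff_X_mul]
    have hne : (⟨i + 1, hi⟩ : Fin m) ≠ ⟨i, by omega⟩ := by simp
    rw [← Finset.sum_subset (Finset.subset_univ {⟨i + 1, hi⟩, ⟨i, by omega⟩}),
      Finset.sum_pair hne]
    · simp
      ring
    · intro x _ hx
      simp only [Finset.mem_insert, Finset.mem_singleton, not_or] at hx
      rw [if_neg (Ne.symm hx.1), if_neg, zero_mul]
      intro h
      exact hx.2 (Fin.ext (by simpa using h.symm))

theorem diffMatrix_pow_mulVec_coeffVec (m r : ℕ) (p : ℝ[X]) :
    (diffMatrix m ^ r).mulVec (coeffVec m p) = coeffVec m ((1 - X) ^ r * p) := by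
  induction r with
  | zero => simp
  | succ r ih =>
    rw [pow_succ', ← Matrix.mulVec_mulVec, ih, diffMatrix_mulVec_coeffVec, pow_succ', mul_assoc]

theorem invDiffPow_mul_pow (m r : ℕ) : invDiffPow m r * diffMatrix m ^ r = 1 := by
  have h : IsUnit (diffMatrix m).det := by simp [det_diffMatrix]
  rw [invDiffPow, Matrix.inv_pow', Matrix.nonsing_inv_mul]
  simp [det_diffMatrix]

/-- The sum `∑ aᵢ X^(ib) φ` of translates of `φ` with weights `aᵢ`. -/
noncomputable def blockPoly (j b : ℕ) (φ : ℝ[X]) (a : Fin j → ℝ) : ℝ[X] :=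
  ∑ i, C (a i) * (φ * X ^ ((i : ℕ) * b))

/-- The first `m` coefficients of `blockPoly`, as a linear map in the weights. -/
noncomputable def blockVec (m j b : ℕ) (φ : ℝ[X]) :
    (Fin j → ℝ) →ₗ[ℝ] EuclideanSpace ℝ (Fin m) where
  toFun a := WithLp.toLp 2 (coeffVec m (blockPoly j b φ a))
  map_add' a a' := by
    ext n
    simp [coeffVec, blockPoly, add_mul, Finset.sum_add_distrib]
  map_smul' c a := by
    ext n
    simp [coeffVec, blockPoly, Finset.mul_sum, mul_assoc]

theorem blockVec_apply (m j b : ℕ) (φ : ℝ[X]) (a : Fin j → ℝ) :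
    blockVec m j b φ a = WithLp.toLp 2 (coeffVec m (blockPoly j b φ a)) := rfl

theorem mul_blockPoly (j b : ℕ) (φ ψ : ℝ[X]) (a : Fin j → ℝ) :
    ψ * blockPoly j b φ a = blockPoly j b (ψ * φ) a := by
  rw [blockPoly, blockPoly, Finset.mul_sum]
  exact Finset.sum_congr rfl fun i _ => by ring

theorem coeff_blockPoly {j b : ℕ} {φ : ℝ[X]} (hφ : φ.natDegree < b) (a : Fin j → ℝ)
    (i : Fin j) {s : ℕ} (hs : s < b) : (blockPoly j b φ a).coeff (i * b + s) = a i * φ.coeff s := by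
  rw [blockPoly, finsetSum_coeff, Finset.sum_eq_single i]
  · rw [coeff_C_mul, add_comm, coeff_mul_X_pow]
  · intro k _ hk
    rw [coeff_C_mul, coeff_mul_X_pow']
    split_ifs with h
    · rw [coeff_eq_zero_of_natDegree_lt, mul_zero]
      have hki : (k : ℕ) < i := by
        rcases lt_trichotomy (k : ℕ) i with h1 | h1 | h1
        · exact h1
        · exact absurd (Fin.ext h1) hk
        · have : ((i : ℕ) + 1) * b ≤ k * b := Nat.mul_le_mul_right _ h1
          rw [add_mul, one_mul] at this
          omega
      have : ((k : ℕ) + 1) * b ≤ i * b := Nat.mul_le_mul_right _ hki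
      rw [add_mul, one_mul] at this
      omega
    · rw [mul_zero]
  · simp

theorem coeff_blockPoly_eq_zero {j b : ℕ} {φ : ℝ[X]} (hφ : φ.natDegree < b) (a : Fin j → ℝ)
    {n : ℕ} (hn : j * b ≤ n) : (blockPoly j b φ a).coeff n = 0 := by
  rw [blockPoly, finsetSum_coeff]
  refine Finset.sum_eq_zero fun k _ => ?_
  rw [coeff_C_mul, coeff_mul_X_pow']
  split_ifs with h
  · rw [coeff_eq_zero_of_natDegree_lt, mul_zero]
    have : ((k : ℕ) + 1) * b ≤ j * b := Nat.mul_le_mul_right _ k.2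
    rw [add_mul, one_mul] at this
    omega
  · rw [mul_zero]

theorem norm_sq_toLp_coeffVec (m : ℕ) (p : ℝ[X]) :
    ‖WithLp.toLp 2 (coeffVec m p)‖ ^ 2 = ∑ n ∈ Finset.range m, p.coeff n ^ 2 := by
  rw [EuclideanSpace.norm_sq_eq, Finset.sum_range]
  simp [coeffVec]

theorem sum_range_mul {M : Type*} [AddCommMonoid M] (f : ℕ → M) (j b : ℕ) :
    ∑ n ∈ Finset.range (j * b), f n =
      ∑ i ∈ Finset.range j, ∑ s ∈ Finset.range b, f (i * b + s) := by
  induction j with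
  | zero => simp
  | succ j ih => rw [add_mul, one_mul, Finset.sum_range_add, ih, Finset.sum_range_succ]

theorem norm_sq_blockVec {m j b : ℕ} (hm : j * b ≤ m) {φ : ℝ[X]} (hφ : φ.natDegree < b)
    (a : Fin j → ℝ) :
    ‖blockVec m j b φ a‖ ^ 2 = (∑ i, a i ^ 2) * ∑ s ∈ Finset.range b, φ.coeff s ^ 2 := by
  rw [blockVec_apply, norm_sq_toLp_coeffVec, ← Finset.sum_subset (Finset.range_mono hm), sum_range_mul,
    Finset.sum_range, Finset.sum_mul]
  · refine Finset.sum_congr rfl fun i _ => ?_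
    rw [Finset.mul_sum]
    refine Finset.sum_congr rfl fun s hs => ?_
    rw [coeff_blockPoly hφ a i (Finset.mem_range.1 hs), mul_pow]
  · intro n _ hn
    rw [coeff_blockPoly_eq_zero hφ a (by simpa using hn)]
    simp

/-- The max-min principle on the space of vectors $D^r y$, with $y$ a combination of disjoint
translates of `φ`: there $D^{-r}$ returns $y$, so only $\|y\|$ and $\|D^r y\|$ need comparing. -/
theorem le_singVal_invDiffPow {m r j b : ℕ} (hj : 1 ≤ j) (hm : j * b ≤ m) {φ : ℝ[X]}
    (hφ : φ.natDegree < b) (hφ0 : φ ≠ 0) {t : ℝ}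
    (h : ∀ a, t * ‖WithLp.toLp 2 (coeffVec m ((1 - X) ^ r * blockPoly j b φ a))‖ ≤
      ‖blockVec m j b φ a‖) :
    t ≤ singVal (invDiffPow m r) j := by
  set T := Matrix.toEuclideanLin (invDiffPow m r)
  set S := Matrix.toEuclideanLin (diffMatrix m ^ r)
  have hTS : ∀ y, T (S y) = y := by
    intro y
    simp only [T, S, Matrix.toLpLin_apply, Matrix.mulVec_mulVec, invDiffPow_mul_pow]
    simp
  have hS : ∀ a, S (blockVec m j b φ a) =
      WithLp.toLp 2 (coeffVec m ((1 - X) ^ r * blockPoly j b φ a)) := by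
    intro a
    rw [← diffMatrix_pow_mulVec_coeffVec]
    rfl
  have hpos : 0 < ∑ s ∈ Finset.range b, φ.coeff s ^ 2 := by
    refine Finset.sum_pos' (fun _ _ => sq_nonneg _)
      ⟨φ.natDegree, Finset.mem_range.2 hφ, ?_⟩
    have : φ.leadingCoeff ≠ 0 := leadingCoeff_ne_zero.2 hφ0
    exact (sq_pos_iff (a := φ.coeff φ.natDegree)).2 this
  have hY : Function.Injective (blockVec m j b φ) := by
    rw [injective_iff_map_eq_zero]
    intro a ha
    have h1 := norm_sq_blockVec hm hφ a
    rw [ha, norm_zero, zero_pow two_ne_zero, eq_comm, mul_eq_zero, or_iff_left hpos.ne',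
      Finset.sum_eq_zero_iff_of_nonneg fun _ _ => sq_nonneg _] at h1
    ext i
    simpa using h1 i (Finset.mem_univ _)
  refine le_singularValues_of_injective T (S ∘ₗ blockVec m j b φ) ?_ (i := j - 1)
    (by simp; omega) ?_
  · intro a a' haa
    apply hY
    have := congrArg T haa
    simpa [hTS] using this
  · intro a
    rw [LinearMap.comp_apply, hTS, hS]
    exact h a

theorem sum_sq_coeff_one_sub_X_mul_le (m : ℕ) (p : ℝ[X]) :
    ∑ n ∈ Finset.range m, ((1 - X) * p).coeff n ^ 2 ≤ 4 * ∑ n ∈ Finset.range m, p.coeff n ^ 2 := by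
  have h1 : ∀ n, ((1 - X) * p).coeff n ^ 2 ≤ 2 * p.coeff n ^ 2 + 2 * (X * p).coeff n ^ 2 := by
    intro n
    rw [sub_mul, one_mul, coeff_sub]
    nlinarith [sq_nonneg (p.coeff n + (X * p).coeff n)]
  have h2 : ∑ n ∈ Finset.range m, (X * p).coeff n ^ 2 ≤ ∑ n ∈ Finset.range m, p.coeff n ^ 2 := by
    rcases m with _ | m
    · simp
    · rw [Finset.sum_range_succ', Finset.sum_range_succ]
      simp only [coeff_X_mul, mul_coeff_zero, coeff_X_zero, zero_mul]
      nlinarith [sq_nonneg (p.coeff m)]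
  calc _ ≤ ∑ n ∈ Finset.range m, (2 * p.coeff n ^ 2 + 2 * (X * p).coeff n ^ 2) :=
        Finset.sum_le_sum fun n _ => h1 n
    _ ≤ _ := by
        rw [Finset.sum_add_distrib, ← Finset.mul_sum, ← Finset.mul_sum]
        linarith

theorem sum_sq_coeff_one_sub_X_pow_mul_le (m r : ℕ) (p : ℝ[X]) :
    ∑ n ∈ Finset.range m, ((1 - X) ^ r * p).coeff n ^ 2 ≤
      4 ^ r * ∑ n ∈ Finset.range m, p.coeff n ^ 2 := by
  induction r with
  | zero => simp
  | succ r ih =>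
    rw [pow_succ', mul_assoc]
    refine (sum_sq_coeff_one_sub_X_mul_le _ _).trans ?_
    rw [pow_succ']
    linarith

theorem singVal_antitone {m n : ℕ} (A : Matrix (Fin m) (Fin n) ℝ) : Antitone (singVal A) :=
  fun _ _ h => (Matrix.toEuclideanLin A).singularValues_antitone (Nat.sub_le_sub_right h 1)

theorem half_pow_le_singVal_invDiffPow {m r j : ℕ} (hj : 1 ≤ j) (hm : j ≤ m) :
    (1 / 2 : ℝ) ^ r ≤ singVal (invDiffPow m r) j := by
  have h : (1 / 2 : ℝ) ^ r ≤ singVal (invDiffPow m r) m := by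
    -- Blocks of length one span the whole space, so the claim reduces to $\|D^r\|\le 2^r$.
    refine le_singVal_invDiffPow (b := 1) (φ := 1) (hj.trans hm) (by simp) (by simp)
      one_ne_zero fun a => ?_
    apply le_of_sq_le_sq _ (norm_nonneg _)
    have h1 : ‖blockVec m m 1 1 a‖ ^ 2 =
        ∑ n ∈ Finset.range m, (blockPoly m 1 1 a).coeff n ^ 2 := by
      rw [blockVec_apply, norm_sq_toLp_coeffVec]
    have h2 : ((1 / 2 : ℝ) ^ r) ^ 2 * 4 ^ r = 1 := by
      rw [← pow_mul, mul_comm r 2, pow_mul, ← mul_pow]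
      norm_num
    rw [mul_pow, norm_sq_toLp_coeffVec, h1]
    refine (mul_le_mul_of_nonneg_left (sum_sq_coeff_one_sub_X_pow_mul_le m r _)
      (sq_nonneg _)).trans_eq ?_
    rw [← mul_assoc, h2, one_mul]
  exact h.trans (singVal_antitone _ hm)

theorem abs_coeff_one_sub_X_pow_mul_le (w r : ℕ) {p : ℝ[X]} {A : ℝ} (hp : ∀ n, |p.coeff n| ≤ A)
    (n : ℕ) : |((1 - X ^ w) ^ r * p).coeff n| ≤ 2 ^ r * A := by
  induction r generalizing n with
  | zero => simpa using hp n
  | succ r ih =>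
    have hA : 0 ≤ A := (abs_nonneg _).trans (hp 0)
    rw [pow_succ', mul_assoc, sub_mul, one_mul, coeff_sub, coeff_X_pow_mul']
    refine (abs_sub _ _).trans ?_
    have h1 := ih n
    have h2 : |if w ≤ n then ((1 - X ^ w) ^ r * p).coeff (n - w) else 0| ≤ 2 ^ r * A := by
      split_ifs
      · exact ih _
      · simpa using by positivity
    rw [pow_succ']
    linarith

/-- The geometric sum `1 + X + ⋯ + X^(w-1)`. -/
noncomputable def geomPoly (w : ℕ) : ℝ[X] := ∑ i ∈ Finset.range w, X ^ i

theorem coeff_geomPoly (w n : ℕ) : (geomPoly w).coeff n = if n < w then 1 else 0 := by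
  simp [geomPoly, coeff_X_pow]

theorem natDegree_geomPoly_le (w : ℕ) : (geomPoly w).natDegree ≤ w - 1 := by
  rw [natDegree_le_iff_coeff_eq_zero]
  intro n hn
  rw [coeff_geomPoly, if_neg (by omega)]

theorem one_sub_X_mul_geomPoly (w : ℕ) : (1 - X) * geomPoly w = 1 - X ^ w :=
  mul_neg_geom_sum X w

/-- The bump has total mass $w^{r+1}$ on a block of length $(r+1)w$, hence energy at least
$w^{2r+1}/(r+1)$ by Cauchy–Schwarz. Its `r`-th difference is $(1-X^w)^r(1+\dots+X^{w-1})$, with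
coefficients at most $2^r$ in size. With exponent `r` in place of `r + 1` the difference would sit
on only $r+1$ points and the ratio of norms would drop to order $w^{r-1/2}$. -/
theorem bump_le_singVal_invDiffPow {m r j w : ℕ} (hj : 1 ≤ j) (hw : 1 ≤ w)
    (hm : j * ((r + 1) * w) ≤ m) :
    (w : ℝ) ^ r / ((r + 1) * 2 ^ r) ≤ singVal (invDiffPow m r) j := by
  set φ := geomPoly w ^ (r + 1) with hφ
  set ψ := (1 - X) ^ r * φ with hψ
  have hψ' : ψ = (1 - X ^ w) ^ r * geomPoly w := by
    rw [hψ, hφ, pow_succ, ← mul_assoc, ← mul_pow, one_sub_X_mul_geomPoly]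
  have hdφ : φ.natDegree ≤ (r + 1) * (w - 1) :=
    natDegree_pow_le.trans (Nat.mul_le_mul_left _ (natDegree_geomPoly_le w))
  have hwr : (r + 1) * w = (r + 1) * (w - 1) + r + 1 := by
    obtain ⟨v, rfl⟩ := Nat.exists_eq_add_of_le' hw
    simp
    ring
  have hdφ' : φ.natDegree < (r + 1) * w := by omega
  -- The degree is at most $r+(r+1)(w-1)=(r+1)w-1$: the differenced bump just fits in its block, so
  -- its translates stay disjoint.
  have hdψ : ψ.natDegree < (r + 1) * w := by
    have h1 : ((1 - X : ℝ[X]) ^ r).natDegree ≤ r * 1 :=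
      natDegree_pow_le.trans (Nat.mul_le_mul_left _ (by
        compute_degree))
    have := natDegree_mul_le (p := (1 - X : ℝ[X]) ^ r) (q := φ)
    rw [← hψ] at this
    omega
  have heval : φ.eval 1 = (w : ℝ) ^ (r + 1) := by
    simp [hφ, geomPoly, eval_finsetSum]
  have hw0 : (0 : ℝ) < w := by exact_mod_cast hw
  have hφ0 : φ ≠ 0 := by
    intro h
    rw [h, eval_zero] at heval
    exact (pow_pos hw0 (r + 1)).ne heval
  have hlow : ((w : ℝ) ^ (r + 1)) ^ 2 ≤
      ((r + 1) * w) * ∑ s ∈ Finset.range ((r + 1) * w), φ.coeff s ^ 2 := by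
    have h1 : (w : ℝ) ^ (r + 1) = ∑ s ∈ Finset.range ((r + 1) * w), φ.coeff s := by
      rw [← heval, eval_eq_sum_range' hdφ']
      simp
    rw [h1]
    refine sq_sum_le_card_mul_sum_sq.trans_eq ?_
    simp
  have hup : ∑ s ∈ Finset.range ((r + 1) * w), ψ.coeff s ^ 2 ≤ ((r + 1) * w) * (2 ^ r) ^ 2 := by
    calc _ ≤ ∑ s ∈ Finset.range ((r + 1) * w), ((2 : ℝ) ^ r) ^ 2 := by
          refine Finset.sum_le_sum fun s _ => ?_
          apply sq_le_sq' <;> [apply neg_le_of_abs_le; apply le_of_abs_le] <;>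
          · rw [hψ']
            have := abs_coeff_one_sub_X_pow_mul_le w r (p := geomPoly w) (A := 1) (by
              intro n
              rw [coeff_geomPoly]
              split_ifs <;> simp) s
            simpa using this
      _ = _ := by simp
  refine le_singVal_invDiffPow hj hm hdφ' hφ0 fun a => ?_
  apply le_of_sq_le_sq _ (norm_nonneg _)
  rw [mul_blockPoly, ← blockVec_apply, ← hψ, mul_pow, norm_sq_blockVec hm hdψ, norm_sq_blockVec hm hdφ', mul_left_comm]
  refine mul_le_mul_of_nonneg_left ?_ (Finset.sum_nonneg fun _ _ => sq_nonneg _)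
  calc _ ≤ ((w : ℝ) ^ r / ((r + 1) * 2 ^ r)) ^ 2 * (((r + 1) * w) * (2 ^ r) ^ 2) := by gcongr
    _ = ((w : ℝ) ^ (r + 1)) ^ 2 / ((r + 1) * w) := by
        field_simp
        ring
    _ ≤ _ := by
        rw [div_le_iff₀ (by positivity)]
        linarith

theorem const_mul_le_singVal_invDiffPow {m r j : ℕ} (hj : 1 ≤ j) (hm : j ≤ m) :
    1 / ((r + 1) * (4 * (r + 1)) ^ r) * ((m : ℝ) / j) ^ r ≤ singVal (invDiffPow m r) j := by
  have hj0 : (0 : ℝ) < j := by exact_mod_cast hj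
  -- When no block of length `r + 1` fits `j` times, `m / j` is bounded and $\|D\|\le2$ suffices.
  -- Otherwise `w` is the floor of $m/(j(r+1))$, and the rounding costs a factor of at most 2.
  rcases lt_or_ge m (j * (r + 1)) with h | h
  · refine le_trans ?_ (half_pow_le_singVal_invDiffPow hj hm)
    have h1 : (m : ℝ) / j ≤ r + 1 := by
      rw [div_le_iff₀ hj0]
      have : (m : ℝ) ≤ j * (r + 1) := by exact_mod_cast h.le
      linarith
    calc _ ≤ 1 / (1 * (2 * (r + 1 : ℝ)) ^ r) * (r + 1 : ℝ) ^ r := by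
          gcongr
          · linarith [(Nat.cast_nonneg r : (0 : ℝ) ≤ r)]
          · norm_num
      _ = _ := by
          rw [one_mul, mul_pow, one_div_pow]
          field_simp
  · set q := j * (r + 1) with hq
    have hq0 : 0 < q := by positivity
    have hw : 1 ≤ m / q := (Nat.one_le_div_iff hq0).2 h
    have hmq : j * ((r + 1) * (m / q)) ≤ m := by
      rw [← mul_assoc, ← hq]
      exact Nat.mul_div_le m q
    refine le_trans ?_ (bump_le_singVal_invDiffPow hj hw hmq)
    have h2 : (m : ℝ) / j ≤ 2 * (r + 1) * (m / q : ℕ) := by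
      rw [div_le_iff₀ hj0]
      have h3 : m < q * (m / q + 1) := Nat.lt_mul_div_succ m hq0
      have h4 : m ≤ q * (2 * (m / q)) := h3.le.trans (Nat.mul_le_mul_left _ (by omega))
      have h5 : (m : ℝ) ≤ (j * (r + 1)) * (2 * (m / q : ℕ)) := by
        exact_mod_cast h4
      linarith
    calc _ ≤ 1 / ((r + 1) * (4 * (r + 1)) ^ r) * (2 * (r + 1) * ((m / q : ℕ) : ℝ)) ^ r := by
          gcongr
      _ = _ := by
          have : (4 * (r + 1 : ℝ)) ^ r = (2 * (r + 1)) ^ r * 2 ^ r := by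
            rw [← mul_pow]
            ring
          rw [this, mul_pow _ ((m / q : ℕ) : ℝ)]
          field_simp

end InvDiffPow

/-! ### Chi-square tail bounds for projected Gaussian vectors. -/

section Gaussian

variable {Ω : Type*} [MeasurableSpace Ω] {P : Measure Ω}

theorem mgf_sq_of_hasLaw_gaussianReal {X : Ω → ℝ} {v : ℝ≥0} (hv : v ≠ 0)
    (hX : HasLaw X (gaussianReal 0 v) P) {t : ℝ} (ht : 2 * t * v < 1) :
    mgf (fun ω => X ω ^ 2) P t = (√(1 - 2 * t * v))⁻¹ := by
  have hv0 : (0 : ℝ) < v := by positivity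
  have h1 : mgf (fun ω => X ω ^ 2) P t = ∫ x, Real.exp (t * x ^ 2) ∂(gaussianReal 0 v) := by
    rw [← hX.map_eq, integral_map hX.aemeasurable (by fun_prop)]
    rfl
  have h2 : ∀ x : ℝ, gaussianPDFReal 0 v x • Real.exp (t * x ^ 2) =
      (√(2 * Real.pi * v))⁻¹ * Real.exp (-((1 - 2 * t * v) / (2 * v)) * x ^ 2) := by
    intro x
    rw [gaussianPDFReal, smul_eq_mul, mul_assoc, ← Real.exp_add]
    congr 2
    field_simp
    ring
  rw [h1, integral_gaussianReal_eq_integral_smul hv]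
  simp_rw [h2]
  rw [integral_const_mul, integral_gaussian, ← Real.sqrt_inv, ← Real.sqrt_inv,
    ← Real.sqrt_mul (by positivity)]
  congr 1
  have : 1 - 2 * t * v ≠ 0 := by linarith
  field_simp

variable {ι κ : Type*} [Fintype ι] [Fintype κ]

/-- Orthogonal linear combinations, with equal norms, of i.i.d. centred Gaussian variables are
i.i.d. centred Gaussian. -/
theorem iIndepFun_hasLaw_orthogonal_comb {g : ι → Ω → ℝ} {v : ℝ≥0}
    (hlaw : ∀ p, HasLaw (g p) (gaussianReal 0 v) P) (hind : iIndepFun g P)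
    (c : κ → ι → ℝ) (s : ℝ≥0) (hs : ∀ a, ∑ p, c a p ^ 2 = s)
    (horth : ∀ a b, a ≠ b → ∑ p, c a p * c b p = 0) :
    iIndepFun (fun a ω => ∑ p, c a p * g p ω) P ∧
      ∀ a, HasLaw (fun ω => ∑ p, c a p * g p ω) (gaussianReal 0 (s * v)) P := by
  have hP := hind.isProbabilityMeasure
  have hg : ∀ p, HasGaussianLaw (g p) P := fun p => (hlaw p).hasGaussianLaw
  have hmem : ∀ p, MemLp (g p) 2 P := fun p => (hg p).memLp_two
  have hjoint : HasGaussianLaw (fun ω p => g p ω) P := iIndepFun.hasGaussianLaw hg hind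
  let L : (ι → ℝ) →L[ℝ] (κ → ℝ) := (Matrix.mulVecLin (Matrix.of c)).toContinuousLinearMap
  have hX : HasGaussianLaw (fun ω a => ∑ p, c a p * g p ω) P := hjoint.map_fun L
  have hcov : ∀ a b, cov[fun ω => ∑ p, c a p * g p ω, fun ω => ∑ p, c b p * g p ω; P] =
      (∑ p, c a p * c b p) * v := by
    intro a b
    rw [covariance_fun_sum_fun_sum (fun p => (hmem p).const_mul _)
      (fun p => (hmem p).const_mul _), Finset.sum_mul]
    refine Finset.sum_congr rfl fun p _ => ?_
    rw [Finset.sum_eq_single p]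
    · rw [covariance_const_mul_left, covariance_const_mul_right,
        covariance_self (hlaw p).aemeasurable, (hlaw p).variance_eq, variance_id_gaussianReal]
      ring
    · intro q _ hq
      rw [covariance_const_mul_left, covariance_const_mul_right,
        (hind.indepFun hq.symm).covariance_eq_zero (hmem p) (hmem q)]
      simp
    · simp
  refine ⟨hX.iIndepFun_of_covariance_eq_zero fun a b hab => ?_, fun a => ?_⟩
  · rw [hcov, horth a b hab, zero_mul]
  · have ha : HasGaussianLaw (fun ω => ∑ p, c a p * g p ω) P := hX.eval a
    refine ⟨ha.aemeasurable, ?_⟩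
    rw [ha.map_eq_gaussianReal]
    congr 1
    · rw [integral_finsetSum _ fun p _ => (hg p).integrable.const_mul _]
      refine Finset.sum_eq_zero fun p _ => ?_
      rw [integral_const_mul, (hlaw p).integral_eq, integral_id_gaussianReal, mul_zero]
    · rw [← covariance_self ha.aemeasurable, hcov]
      have : ∑ p, c a p * c a p = s := by
        rw [← hs a]
        exact Finset.sum_congr rfl fun p _ => (sq _).symm
      rw [this]
      apply NNReal.eq
      simp only [Real.coe_toNNReal', NNReal.coe_mul]
      exact max_eq_left (by positivity)

theorem mgf_sum_sq_orthogonal_comb {g : ι → Ω → ℝ} {v : ℝ≥0} (hv : v ≠ 0)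
    (hlaw : ∀ p, HasLaw (g p) (gaussianReal 0 v) P) (hind : iIndepFun g P)
    (c : κ → ι → ℝ) {s : ℝ≥0} (hs0 : s ≠ 0) (hs : ∀ a, ∑ p, c a p ^ 2 = s)
    (horth : ∀ a b, a ≠ b → ∑ p, c a p * c b p = 0) {t : ℝ} (ht : 2 * t * (s * v) < 1) :
    mgf (fun ω => ∑ a, (∑ p, c a p * g p ω) ^ 2) P t =
        (√(1 - 2 * t * (s * v)))⁻¹ ^ Fintype.card κ ∧
      Integrable (fun ω => Real.exp (t * ∑ a, (∑ p, c a p * g p ω) ^ 2)) P := by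
  obtain ⟨h1, h2⟩ := iIndepFun_hasLaw_orthogonal_comb hlaw hind c s hs horth
  have hmeas : ∀ a, AEMeasurable (fun ω => (∑ p, c a p * g p ω) ^ 2) P :=
    fun a => (h2 a).aemeasurable.pow_const 2
  have hsq : iIndepFun (fun a ω => (∑ p, c a p * g p ω) ^ 2) P :=
    h1.comp (fun _ x => x ^ 2) fun _ => by fun_prop
  have hmgf : mgf (fun ω => ∑ a, (∑ p, c a p * g p ω) ^ 2) P t =
      (√(1 - 2 * t * (s * v)))⁻¹ ^ Fintype.card κ := by
    have := hsq.mgf_sum₀ (t := t) hmeas Finset.univ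
    rw [Finset.sum_fn] at this
    rw [this, Finset.prod_congr rfl fun a _ =>
      mgf_sq_of_hasLaw_gaussianReal (mul_ne_zero hs0 hv) (h2 a) (t := t) (by simpa using ht)]
    simp
  refine ⟨hmgf, ?_⟩
  -- A non-integrable exponential would have `mgf` equal to the default value 0, but the value just
  -- computed is positive.
  by_contra hcon
  have h0 := mgf_undef hcon
  rw [hmgf] at h0
  have : 0 < √(1 - 2 * t * (s * v)) := Real.sqrt_pos.2 (by linarith)
  exact (pow_pos (inv_pos.2 this) _).ne' h0

variable {m N l : ℕ}

/-- `‖B Φ z‖²`, where the rows of `B` are given. -/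
noncomputable def projSq (B : Fin l → EuclideanSpace ℝ (Fin m)) (A : Matrix (Fin m) (Fin N) ℝ)
    (z : Fin N → ℝ) : ℝ :=
  ∑ a, inner ℝ (B a) (WithLp.toLp 2 (A.mulVec z)) ^ 2

theorem inner_toLp_mulVec (b : EuclideanSpace ℝ (Fin m)) (A : Matrix (Fin m) (Fin N) ℝ)
    (z : Fin N → ℝ) :
    inner ℝ b (WithLp.toLp 2 (A.mulVec z)) = ∑ p : Fin m × Fin N, b p.1 * z p.2 * A p.1 p.2 := by
  rw [PiLp.inner_apply, Fintype.sum_prod_type]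
  refine Finset.sum_congr rfl fun i _ => ?_
  simp only [Matrix.mulVec, dotProduct, RCLike.inner_apply, conj_trivial, Finset.sum_mul]
  exact Finset.sum_congr rfl fun j _ => by ring

/-- The coefficient arrays $B_a\otimes z$ are orthogonal with common squared norm $\|z\|^2$, so the
`l` coordinates are i.i.d. of variance $\|z\|^2/m$. -/
theorem mgf_projSq {Φ : Ω → Matrix (Fin m) (Fin N) ℝ} (hm : 1 ≤ m)
    (hΦ : IsGaussianMatrix P Φ) {B : Fin l → EuclideanSpace ℝ (Fin m)} (hB : Orthonormal ℝ B)
    {z : Fin N → ℝ} (hz : 0 < ∑ j, z j ^ 2) {t : ℝ} (ht : 2 * t * (∑ j, z j ^ 2) < m) :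
    mgf (fun ω => projSq B (Φ ω) z) P t = (√(1 - 2 * t * (∑ j, z j ^ 2) / m))⁻¹ ^ l ∧
      Integrable (fun ω => Real.exp (t * projSq B (Φ ω) z)) P := by
  have hm0 : (0 : ℝ) < m := by exact_mod_cast hm
  have hprod : ∀ a b, ∑ p : Fin m × Fin N, B a p.1 * z p.2 * (B b p.1 * z p.2) =
      inner ℝ (B a) (B b) * ∑ j, z j ^ 2 := by
    intro a b
    rw [PiLp.inner_apply, Fintype.sum_prod_type, Finset.sum_mul_sum]
    refine Finset.sum_congr rfl fun i _ => Finset.sum_congr rfl fun j _ => ?_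
    simp
    ring
  set s : ℝ≥0 := ⟨∑ j, z j ^ 2, hz.le⟩ with hs
  have hsr : (s : ℝ) = ∑ j, z j ^ 2 := rfl
  have hmv : (1 / (m : ℝ≥0)) ≠ 0 := by positivity
  have key := mgf_sum_sq_orthogonal_comb (t := t) hmv (fun p : Fin m × Fin N => hΦ.law p.1 p.2) hΦ.indep
    (fun (a : Fin l) (p : Fin m × Fin N) => B a p.1 * z p.2) (s := s) (fun h => hz.ne' (by rw [← hsr, h]; rfl))
    (fun a => by
      simp_rw [sq]
      rw [hprod, real_inner_self_eq_norm_sq, hB.1 a, hsr]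
      simp [sq])
    (fun a b hab => by rw [hprod, hB.2 hab, zero_mul])
    (by
      push_cast
      rw [hsr, mul_one_div, ← mul_div_assoc, div_lt_one hm0]
      exact ht)
  simp only [projSq, inner_toLp_mulVec]
  convert key using 2
  rw [Fintype.card_fin]
  push_cast
  rw [hsr, mul_one_div, mul_div_assoc]

theorem projSq_small_ball [IsProbabilityMeasure P] {Φ : Ω → Matrix (Fin m) (Fin N) ℝ}
    (hm : 1 ≤ m) (hΦ : IsGaussianMatrix P Φ) {B : Fin l → EuclideanSpace ℝ (Fin m)}
    (hB : Orthonormal ℝ B) {z : Fin N → ℝ} (hz : 1 / 4 ≤ ∑ j, z j ^ 2) {ε : ℝ} (hε : 0 < ε) :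
    P.real {ω | projSq B (Φ ω) z ≤ ε ^ 2 * (l / m)} ≤ (4 * ε) ^ l := by
  have hm0 : (0 : ℝ) < m := by exact_mod_cast hm
  set S := ∑ j, z j ^ 2
  have hS : 0 < S := by linarith
  have hneg : -(m / ε ^ 2) ≤ 0 := by
    have : 0 ≤ m / ε ^ 2 := by positivity
    linarith
  -- Chernoff at $t=-m/\varepsilon^2$ costs $e\sqrt2\,\varepsilon<4\varepsilon$ per coordinate; `7 /
  -- 10` below stands for $1/\sqrt2$.
  obtain ⟨h1, h2⟩ := mgf_projSq hm hΦ hB hS (t := -(m / ε ^ 2)) (by nlinarith)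
  refine (measure_le_le_exp_mul_mgf _ hneg h2).trans ?_
  have h3 : -(-(m / ε ^ 2)) * (ε ^ 2 * (l / m)) = l * 1 := by field_simp
  rw [h1, h3, Real.exp_nat_mul, ← mul_pow]
  refine pow_le_pow_left₀ (by positivity) ?_ l
  have h4 : 1 / (2 * ε ^ 2) ≤ 1 - 2 * -(m / ε ^ 2) * S / m := by
    have : 1 - 2 * -(m / ε ^ 2) * S / m = 1 + 2 * S / ε ^ 2 := by
      field_simp
      ring
    rw [this]
    have h5 : 1 / (2 * ε ^ 2) ≤ 2 * S / ε ^ 2 := by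
      rw [div_le_div_iff₀ (by positivity) (by positivity)]
      nlinarith [sq_nonneg ε]
    linarith
  have h6 : (7 / (10 * ε)) ≤ √(1 - 2 * -(m / ε ^ 2) * S / m) := by
    apply Real.le_sqrt_of_sq_le
    refine le_trans ?_ h4
    rw [div_pow, div_le_div_iff₀ (by positivity) (by positivity)]
    nlinarith [sq_nonneg ε]
  have h7 : (√(1 - 2 * -(m / ε ^ 2) * S / m))⁻¹ ≤ (7 / (10 * ε))⁻¹ := by gcongr
  rw [inv_div] at h7
  calc Real.exp 1 * (√(1 - 2 * -(m / ε ^ 2) * S / m))⁻¹ ≤ 2.8 * (10 * ε / 7) := by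
        gcongr
        linarith [Real.exp_one_lt_d9]
    _ = 4 * ε := by ring

theorem projSq_large_deviation [IsProbabilityMeasure P] {Φ : Ω → Matrix (Fin m) (Fin N) ℝ}
    (hm : 1 ≤ m) (hΦ : IsGaussianMatrix P Φ) {B : Fin l → EuclideanSpace ℝ (Fin m)}
    (hB : Orthonormal ℝ B) (q : Fin N) :
    P.real {ω | 16 * (l / m) ≤ projSq B (Φ ω) (Pi.single q 1)} ≤ Real.exp (-3 * l) := by
  have hm0 : (0 : ℝ) < m := by exact_mod_cast hm
  have hS : ∑ j, (Pi.single q 1 : Fin N → ℝ) j ^ 2 = 1 := by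
    rw [Finset.sum_eq_single q] <;> simp +contextual
  obtain ⟨h1, h2⟩ := mgf_projSq hm hΦ hB (z := Pi.single q 1) (by rw [hS]; norm_num)
    (t := m / 4) (by rw [hS]; linarith)
  refine (measure_ge_le_exp_mul_mgf _ (by positivity) h2).trans ?_
  have h3 : -((m : ℝ) / 4) * (16 * (l / m)) = l * (-4) := by
    field_simp
    norm_num
  have h4 : -3 * (l : ℝ) = l * (-4 + 1) := by ring
  have h5 : 1 - 2 * ((m : ℝ) / 4) * 1 / m = 1 / 2 := by
    field_simp
    norm_num
  rw [h1, h3, h4, Real.exp_nat_mul, Real.exp_nat_mul, ← mul_pow, hS, h5, Real.exp_add]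
  gcongr
  have h6 : (1 / 2 : ℝ) ≤ √(1 / 2) := Real.le_sqrt_of_sq_le (by norm_num)
  calc (√(1 / 2))⁻¹ ≤ ((1 / 2 : ℝ))⁻¹ := by gcongr
    _ ≤ Real.exp 1 := by
        have := Real.add_one_le_exp (1 : ℝ)
        norm_num
        linarith

end Gaussian

/-! ### Passing from a finite grid to the unit sphere. -/

section Net

/-- Rounding each coordinate down to a multiple of `1 / M` changes `G x` by at most `k * R / M`, so
only a bound on the columns is needed and no operator norm. The rounded point leaves the sphere but
keeps squared norm at least 1/4. -/
theorem le_norm_of_grid {F : Type*} [NormedAddCommGroup F] [NormedSpace ℝ F] {k M : ℕ}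
    (G : (Fin k → ℝ) →ₗ[ℝ] F) (hM0 : 1 ≤ M) (hM : 2 * k ≤ M) {R s : ℝ}
    (hR : ∀ j, ‖G (Pi.single j 1)‖ ≤ R)
    (hgrid : ∀ u : Fin k → ℤ, (∀ j, u j ∈ Finset.Icc (-M : ℤ) M) →
      1 / 4 ≤ ∑ j, ((u j : ℝ) / M) ^ 2 → s + k * R / M ≤ ‖G fun j => (u j : ℝ) / M‖)
    {x : Fin k → ℝ} (hx : ∑ j, x j ^ 2 = 1) : s ≤ ‖G x‖ := by
  have hM0' : (0 : ℝ) < M := by exact_mod_cast hM0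
  have hxj : ∀ j, |x j| ≤ 1 := by
    intro j
    rw [← sq_le_one_iff_abs_le_one, ← hx]
    exact Finset.single_le_sum (f := fun j => x j ^ 2) (fun _ _ => sq_nonneg _)
      (Finset.mem_univ j)
  set u : Fin k → ℤ := fun j => ⌊M * x j⌋ with hu
  set y : Fin k → ℝ := fun j => (u j : ℝ) / M with hy
  have hd : ∀ j, |x j - y j| ≤ 1 / M := by
    intro j
    have h1 := Int.floor_le (M * x j)
    have h2 := Int.lt_floor_add_one (M * x j)
    have h3 : x j - y j = (M * x j - u j) / M := by
      simp only [hy]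
      field_simp
    rw [h3, abs_div, abs_of_pos hM0']
    gcongr
    rw [abs_le]
    constructor <;> simp only [hu] <;> linarith
  have humem : ∀ j, u j ∈ Finset.Icc (-M : ℤ) M := by
    intro j
    obtain ⟨h1, h2⟩ := abs_le.1 (hxj j)
    rw [Finset.mem_Icc]
    constructor
    · apply Int.le_floor.2
      push_cast
      nlinarith
    · have : (u j : ℝ) ≤ M := (Int.floor_le _).trans (by nlinarith)
      exact_mod_cast this
  have hysq : 1 / 4 ≤ ∑ j, y j ^ 2 := by
    have h1 : ∑ j, x j ^ 2 ≤ ∑ j, (2 * y j ^ 2 + 2 * (1 / (M : ℝ)) ^ 2) := by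
      refine Finset.sum_le_sum fun j _ => ?_
      have := sq_le_sq' (abs_le.1 (hd j)).1 (abs_le.1 (hd j)).2
      -- This is $x^2\le 2y^2+2(x-y)^2$, whose defect is $(x-2y)^2$.
      nlinarith [sq_nonneg (x j - 2 * y j)]
    rw [hx, Finset.sum_add_distrib, ← Finset.mul_sum, Finset.sum_const, Finset.card_univ,
      Fintype.card_fin, nsmul_eq_mul] at h1
    have h2 : (k : ℝ) * (2 * (1 / (M : ℝ)) ^ 2) ≤ 1 / 2 := by
      have hk : 4 * (k : ℝ) ≤ M ^ 2 := by
        have : 4 * k ≤ M ^ 2 := by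
          rcases k with _ | k
          · simp
          · nlinarith
        exact_mod_cast this
      rw [one_div, inv_pow]
      field_simp
      linarith
    linarith
  have hG : ‖G (x - y)‖ ≤ k * R / M := by
    have h1 : G (x - y) = ∑ j, (x j - y j) • G (Pi.single j 1) := by
      conv_lhs => rw [LinearMap.pi_apply_eq_sum_univ G (x - y)]
      refine Finset.sum_congr rfl fun j _ => ?_
      congr 2
      ext i
      simp [Pi.single_apply, eq_comm]
    rw [h1]
    calc _ ≤ ∑ j : Fin k, 1 / (M : ℝ) * R := by
          refine (norm_sum_le _ _).trans (Finset.sum_le_sum fun j _ => ?_)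
          rw [norm_smul, Real.norm_eq_abs]
          exact mul_le_mul (hd j) (hR j) (norm_nonneg _) (by positivity)
      _ = k * R / M := by
          rw [Finset.sum_const, Finset.card_univ, Fintype.card_fin, nsmul_eq_mul]
          ring
  have h1 := hgrid u humem hysq
  have h2 : ‖G y‖ ≤ ‖G x‖ + ‖G (x - y)‖ := by
    have : G y = G x - G (x - y) := by rw [← map_sub, sub_sub_cancel]
    rw [this]
    exact norm_sub_le _ _
  change s + k * R / M ≤ ‖G y‖ at h1
  linarith

end Net

/-! ### Reduction from column submatrices to grid points. -/

section Deterministic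

variable {m N l k : ℕ}

/-- The vector supported on the range of `f` with entries `x`. -/
noncomputable def extendVec (f : Fin k → Fin N) : (Fin k → ℝ) →ₗ[ℝ] (Fin N → ℝ) :=
  ∑ j, (LinearMap.proj j).smulRight (Pi.single (f j) 1)

theorem extendVec_apply (f : Fin k → Fin N) (x : Fin k → ℝ) :
    extendVec f x = ∑ j, x j • Pi.single (f j) (1 : ℝ) := by
  simp [extendVec]

theorem extendVec_single (f : Fin k → Fin N) (j : Fin k) :
    extendVec f (Pi.single j 1) = Pi.single (f j) 1 := by
  rw [extendVec_apply, Finset.sum_eq_single j] <;> simp +contextual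

theorem sum_sq_extendVec {f : Fin k → Fin N} (hf : Function.Injective f) (x : Fin k → ℝ) :
    ∑ q, extendVec f x q ^ 2 = ∑ j, x j ^ 2 := by
  have h1 : ∀ j, extendVec f x (f j) = x j := by
    intro j
    rw [extendVec_apply, Finset.sum_apply, Finset.sum_eq_single j]
    · simp
    · intro i _ hi
      simp [hf.eq_iff, hi.symm]
    · simp
  rw [← Finset.sum_subset (Finset.subset_univ (Finset.univ.map ⟨f, hf⟩)), Finset.sum_map]
  · simp [h1]
  · intro q _ hq
    rw [extendVec_apply, Finset.sum_apply, Finset.sum_eq_zero, zero_pow two_ne_zero]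
    intro j _
    have : q ≠ f j := by
      rintro rfl
      simp at hq
    simp [this]

theorem mulVec_extendVec (A : Matrix (Fin m) (Fin N) ℝ) (f : Fin k → Fin N) (x : Fin k → ℝ) :
    A.mulVec (extendVec f x) = (A.submatrix id f).mulVec x := by
  rw [extendVec_apply, Matrix.mulVec_sum]
  ext i
  rw [Finset.sum_apply]
  refine Finset.sum_congr rfl fun j _ => ?_
  rw [Matrix.mulVec_smul, Matrix.mulVec_single_one]
  exact mul_comm _ _

/-- The coordinates of `A z` along the orthonormal family `B`. -/
noncomputable def projMap (B : Fin l → EuclideanSpace ℝ (Fin m)) (A : Matrix (Fin m) (Fin N) ℝ) :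
    (Fin N → ℝ) →ₗ[ℝ] EuclideanSpace ℝ (Fin l) where
  toFun z := WithLp.toLp 2 fun a => inner ℝ (B a) (WithLp.toLp 2 (A.mulVec z))
  map_add' z z' := by
    ext a
    simp [Matrix.mulVec_add, inner_add_right]
  map_smul' c z := by
    ext a
    simp [Matrix.mulVec_smul, inner_smul_right]

theorem norm_sq_projMap (B : Fin l → EuclideanSpace ℝ (Fin m)) (A : Matrix (Fin m) (Fin N) ℝ)
    (z : Fin N → ℝ) : ‖projMap B A z‖ ^ 2 = projSq B A z := by
  rw [EuclideanSpace.norm_sq_eq]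
  simp [projMap, projSq]

theorem le_singMin {E : Matrix (Fin m) (Fin k) ℝ} (hk : 1 ≤ k) {t : ℝ}
    (h : ∀ x : Fin k → ℝ, ∑ j, x j ^ 2 = 1 → t ≤ ‖WithLp.toLp 2 (E.mulVec x)‖) :
    t ≤ singMin E := by
  refine le_singularValues_of_injective (Matrix.toEuclideanLin E) LinearMap.id
    Function.injective_id (i := k - 1) (by simp; omega) fun x => ?_
  rw [LinearMap.id_apply]
  rcases eq_or_ne x 0 with rfl | hx
  · simp
  have hx0 : 0 < ‖x‖ := norm_pos_iff.2 hx
  have h1 := h (‖x‖⁻¹ • x.ofLp) (by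
    have h2 := EuclideanSpace.norm_sq_eq (‖x‖⁻¹ • x)
    rw [norm_smul, norm_inv, norm_norm, inv_mul_cancel₀ hx0.ne'] at h2
    simpa [mul_pow] using h2.symm)
  rw [Matrix.mulVec_smul, WithLp.toLp_smul, norm_smul, norm_inv, norm_norm] at h1
  rw [inv_mul_eq_div, le_div_iff₀ hx0] at h1
  exact h1

theorem le_singMin_mul_submatrix {H : Matrix (Fin m) (Fin m) ℝ} {A : Matrix (Fin m) (Fin N) ℝ}
    {B : Fin l → EuclideanSpace ℝ (Fin m)} {σ : ℝ} (hσ : 0 ≤ σ)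
    (hB : ∀ x, σ ^ 2 * ∑ a, inner ℝ (B a) x ^ 2 ≤ ‖Matrix.toEuclideanLin H x‖ ^ 2)
    (hk : 1 ≤ k) {M : ℕ} (hM0 : 1 ≤ M) (hM : 2 * k ≤ M) {R s : ℝ} (hs : 0 ≤ s)
    (hR : ∀ q, ‖projMap B A (Pi.single q 1)‖ ≤ R) (f : Fin k → Fin N)
    (hgrid : ∀ u : Fin k → ℤ, (∀ j, u j ∈ Finset.Icc (-M : ℤ) M) →
      1 / 4 ≤ ∑ j, ((u j : ℝ) / M) ^ 2 →
      s + k * R / M ≤ ‖projMap B A (extendVec f fun j => (u j : ℝ) / M)‖) :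
    σ * s ≤ singMin (H * A.submatrix id f) := by
  refine le_singMin hk fun x hx => ?_
  have h1 : s ≤ ‖(projMap B A ∘ₗ extendVec f) x‖ :=
    le_norm_of_grid _ hM0 hM (fun j => by
      rw [LinearMap.comp_apply, extendVec_single]
      exact hR _) hgrid hx
  apply le_of_sq_le_sq _ (norm_nonneg _)
  rw [LinearMap.comp_apply] at h1
  calc (σ * s) ^ 2 ≤ (σ * ‖projMap B A (extendVec f x)‖) ^ 2 := by gcongr
    _ = σ ^ 2 * projSq B A (extendVec f x) := by rw [mul_pow, norm_sq_projMap]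
    _ ≤ _ := by
      refine (hB _).trans_eq ?_
      rw [mulVec_extendVec, ← Matrix.mulVec_mulVec]
      rfl

end Deterministic

/-! ### The union bound over supports and grid points. -/

section UnionBound

variable {Ω : Type*} [MeasurableSpace Ω] {P : Measure Ω} [IsProbabilityMeasure P] {m N l k : ℕ}

theorem prob_singMin_mul_submatrix_ge {Φ : Ω → Matrix (Fin m) (Fin N) ℝ} (hm : 1 ≤ m)
    (hΦ : IsGaussianMatrix P Φ) (hk : 1 ≤ k) (hl : l ≤ m) (H : Matrix (Fin m) (Fin m) ℝ) :
    1 - (((N : ℝ) ^ k * (2 * (16000 * k) + 1) ^ k) * (1 / 500) ^ l + N * Real.exp (-3 * l)) ≤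
      P.real {ω | ∀ T : Fin k ↪o Fin N, singVal H l * (1 / 4000 * √(l / m)) ≤
        singMin (H * (Φ ω).submatrix id T)} := by
  classical
  obtain ⟨B, hBo, hB⟩ := exists_orthonormal_singularValues_le (Matrix.toEuclideanLin H)
    (l := l) (by simpa using hl)
  -- With columns bounded by `4 * ρ`, this mesh makes the rounding loss `ρ / 4000`, half of the
  -- small-ball radius `ρ / 2000`; the small-ball base is then $4/2000=1/500$.
  set M := 16000 * k with hM
  have hM0 : (0 : ℝ) < M := by
    rw [hM]
    exact_mod_cast Nat.mul_pos (by norm_num) hk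
  set ρ := √((l : ℝ) / m) with hρ
  have hρ0 : 0 ≤ ρ := Real.sqrt_nonneg _
  have hρsq : ρ ^ 2 = (l : ℝ) / m := Real.sq_sqrt (by positivity)
  let z : (Fin k → Fin N) → (Fin k → ℤ) → (Fin N → ℝ) :=
    fun f u => extendVec f fun j => (u j : ℝ) / M
  let I : Finset ((Fin k → Fin N) × (Fin k → ℤ)) :=
    (Finset.univ ×ˢ Fintype.piFinset fun _ => Finset.Icc (-M : ℤ) M).filter
      fun p => 1 / 4 ≤ ∑ q, z p.1 p.2 q ^ 2
  set S := {ω | ∀ T : Fin k ↪o Fin N, singVal H l * (1 / 4000 * ρ) ≤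
        singMin (H * (Φ ω).submatrix id T)} with hS
  let U₁ := ⋃ p ∈ I, {ω | projSq B (Φ ω) (z p.1 p.2) ≤ (1 / 2000) ^ 2 * (l / m)}
  let U₂ := ⋃ q ∈ (Finset.univ : Finset (Fin N)),
    {ω | 16 * ((l : ℝ) / m) ≤ projSq B (Φ ω) (Pi.single q 1)}
  have hcover : Set.univ ⊆ S ∪ (U₁ ∪ U₂) := by
    intro ω _
    by_contra hω
    simp only [Set.mem_union, not_or] at hω
    obtain ⟨hωS, hω1, hω2⟩ := hω
    refine hωS fun T => ?_
    refine le_singMin_mul_submatrix (R := 4 * ρ) (M := M)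
      ((Matrix.toEuclideanLin H).singularValues_nonneg _) hB hk
      (by omega) (by omega) (by positivity) (fun q => ?_) T fun u hu hu4 => ?_
    · apply le_of_sq_le_sq _ (by positivity)
      rw [norm_sq_projMap, mul_pow, hρsq]
      simp only [U₂, Set.mem_iUnion, Set.mem_ofPred_eq, not_exists, not_le] at hω2
      have := hω2 q (Finset.mem_univ _)
      linarith
    · have hmem : ((T : Fin k → Fin N), u) ∈ I := by
        simp only [I, Finset.mem_filter, Finset.mem_product, Finset.mem_univ, true_and,
          Fintype.mem_piFinset]
        exact ⟨hu, by rw [sum_sq_extendVec T.injective]; exact hu4⟩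
      simp only [U₁, Set.mem_iUnion, Set.mem_ofPred_eq, not_exists, not_le] at hω1
      have h1 := hω1 _ hmem
      have h2 : 1 / 4000 * ρ + k * (4 * ρ) / M = 1 / 2000 * ρ := by
        have : (k : ℝ) ≠ 0 := by positivity
        rw [hM]
        push_cast
        field_simp
        ring
      rw [h2]
      apply le_of_sq_le_sq _ (norm_nonneg _)
      rw [norm_sq_projMap, mul_pow, hρsq]
      exact h1.le
  have hU1 : P.real U₁ ≤ ((N : ℝ) ^ k * (2 * (16000 * k) + 1) ^ k) * (1 / 500) ^ l := by
    refine (measureReal_biUnion_finset_le _ _).trans ?_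
    calc _ ≤ ∑ p ∈ I, (1 / 500 : ℝ) ^ l := by
          refine Finset.sum_le_sum fun p hp => ?_
          refine (projSq_small_ball hm hΦ hBo (Finset.mem_filter.1 hp).2
            (ε := 1 / 2000) (by norm_num)).trans_eq ?_
          norm_num
      _ = (I.card : ℝ) * (1 / 500) ^ l := by rw [Finset.sum_const, nsmul_eq_mul]
      _ ≤ _ := by
          gcongr
          have hc : I.card ≤ N ^ k * (2 * (16000 * k) + 1) ^ k := by
            refine (Finset.card_filter_le _ _).trans_eq ?_
            rw [Finset.card_product, Fintype.card_piFinset]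
            have : ((M : ℤ) + 1 + M).toNat = 2 * (16000 * k) + 1 := by omega
            simp [this]
          exact_mod_cast hc
  have hU2 : P.real U₂ ≤ N * Real.exp (-3 * l) := by
    refine (measureReal_biUnion_finset_le _ _).trans ?_
    refine (Finset.sum_le_sum fun q _ => projSq_large_deviation hm hΦ hBo q).trans_eq ?_
    simp
  -- Subadditivity on a cover of the whole space avoids complements, so `S` need not be shown
  -- measurable.
  have h1 : (1 : ℝ) ≤ P.real S + (P.real U₁ + P.real U₂) := by
    calc (1 : ℝ) = P.real Set.univ := by simp
      _ ≤ P.real (S ∪ (U₁ ∪ U₂)) := measureReal_mono hcover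
      _ ≤ P.real S + P.real (U₁ ∪ U₂) := measureReal_union_le _ _
      _ ≤ _ := by
        gcongr
        exact measureReal_union_le _ _
  linarith

end UnionBound

/-! ### Numerical estimates. -/

theorem union_bound_le_exp {N k l : ℕ} {L : ℝ} (hk : 1 ≤ k) (hkN : k ≤ N) (hL : 22 ≤ L)
    (hN : Real.log N ≤ L) (hl : k * L ≤ 2 * l) :
    ((N : ℝ) ^ k * (2 * (16000 * k) + 1) ^ k) * (1 / 500) ^ l + N * Real.exp (-3 * l) ≤
      2 * Real.exp (-(l : ℝ)) := by
  have hN0 : (0 : ℝ) < N := by exact_mod_cast hk.trans hkN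
  have hk1 : (1 : ℝ) ≤ k := by exact_mod_cast hk
  have hkN' : (k : ℝ) ≤ N := by exact_mod_cast hkN
  have hNL : (N : ℝ) ≤ Real.exp L := (Real.log_le_iff_le_exp hN0).1 hN
  have hNk : (N : ℝ) ^ k ≤ Real.exp (2 * l) := by
    calc (N : ℝ) ^ k ≤ Real.exp L ^ k := by gcongr
      _ = Real.exp (k * L) := (Real.exp_nat_mul _ _).symm
      _ ≤ _ := Real.exp_le_exp.2 hl
  -- The exponents balance as $2+3-6=-1$: supports, grid points, small ball. The assumption `22 ≤ L`
  -- absorbs 32001 into $e^{L/2}$.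
  have hgrid : (2 * (16000 * (k : ℝ)) + 1) ^ k ≤ Real.exp (3 * l) := by
    have h1 : 2 * (16000 * (k : ℝ)) + 1 ≤ Real.exp (L / 2) * Real.exp L := by
      have h2 : (32001 : ℝ) ≤ Real.exp (L / 2) := by
        calc (32001 : ℝ) ≤ 2.7 ^ 11 := by norm_num
          _ ≤ Real.exp 1 ^ 11 := by
              gcongr
              linarith [Real.exp_one_gt_d9]
          _ = Real.exp 11 := by rw [← Real.exp_nat_mul]; norm_num
          _ ≤ _ := Real.exp_le_exp.2 (by linarith)
      calc _ ≤ 32001 * (k : ℝ) := by linarith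
        _ ≤ _ := by
            gcongr
            linarith
    calc _ ≤ (Real.exp (L / 2) * Real.exp L) ^ k := by gcongr
      _ = Real.exp (k * (L / 2 + L)) := by rw [← Real.exp_add, ← Real.exp_nat_mul]
      _ ≤ _ := Real.exp_le_exp.2 (by linarith)
  have hball : (1 / 500 : ℝ) ^ l ≤ Real.exp (-6 * l) := by
    have h1 : Real.exp 6 ≤ 500 := by
      calc Real.exp 6 = Real.exp 1 ^ 6 := by rw [← Real.exp_nat_mul]; norm_num
        _ ≤ 2.72 ^ 6 := by
            gcongr
            linarith [Real.exp_one_lt_d9]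
        _ ≤ 500 := by norm_num
    rw [mul_comm, Real.exp_nat_mul, Real.exp_neg]
    gcongr
    rw [one_div]
    gcongr
  have hN1 : (N : ℝ) ≤ Real.exp (2 * l) :=
    (le_self_pow₀ (by exact_mod_cast hk.trans hkN) (by omega)).trans hNk
  have h1 : ((N : ℝ) ^ k * (2 * (16000 * k) + 1) ^ k) * (1 / 500) ^ l ≤ Real.exp (-(l : ℝ)) := by
    calc _ ≤ (Real.exp (2 * l) * Real.exp (3 * l)) * Real.exp (-6 * l) := by gcongr
      _ = _ := by
          rw [← Real.exp_add, ← Real.exp_add]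
          ring_nf
  have h2 : N * Real.exp (-3 * l) ≤ Real.exp (-(l : ℝ)) := by
    calc _ ≤ Real.exp (2 * l) * Real.exp (-3 * l) := by gcongr
      _ = _ := by
          rw [← Real.exp_add]
          ring_nf
  linarith

theorem rpow_le_pow_mul_sqrt {r : ℕ} (hr : 1 ≤ r) {b y : ℝ} (hb : 0 < b) (hby : b ≤ y) :
    b ^ ((r : ℝ) - 1 / 2) ≤ y ^ r * √(1 / y) := by
  have hy : 0 < y := hb.trans_le hby
  have hr1 : (1 : ℝ) ≤ r := by exact_mod_cast hr
  calc b ^ ((r : ℝ) - 1 / 2) ≤ y ^ ((r : ℝ) - 1 / 2) := by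
        gcongr
        linarith
    _ = _ := by
        rw [Real.rpow_sub hy, Real.rpow_natCast, one_div y, Real.sqrt_inv, ← Real.sqrt_eq_rpow,
          div_eq_mul_inv]

end SigmaDelta

/-! ### Choice of constants and assembly. -/

theorem mainTheorem3 (r : ℕ) (hr : 1 ≤ r) :
    ∃ c₁ c₆ c₇ : ℝ, 0 < c₁ ∧ 0 < c₆ ∧ 0 < c₇ ∧
      (∀ m j : ℕ, 1 ≤ j → j ≤ m →
        c₁ * ((m : ℝ) / (j : ℝ)) ^ r ≤ SigmaDelta.singVal (SigmaDelta.invDiffPow m r) j) ∧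
      ∀ (α : ℝ), 0 < α → α < 1 →
      ∀ (m k N : ℕ), 1 ≤ m → 1 ≤ k → k ≤ N →
      ∀ (lam : ℝ), lam = (m : ℝ) / (k : ℝ) →
        c₆ * Real.log (N : ℝ) ^ (1 / (1 - α)) ≤ lam →
      ∀ (Ω : Type*) [MeasurableSpace Ω] (P : Measure Ω) [IsProbabilityMeasure P]
        (Φ : Ω → Matrix (Fin m) (Fin N) ℝ), SigmaDelta.IsGaussianMatrix P Φ →
        1 - 2 * Real.exp (-(c₇ * (m : ℝ) * lam ^ (-α))) ≤
          P.real {ω | ∀ T : Fin k ↪o Fin N,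
            c₁ * lam ^ (α * ((r : ℝ) - 1 / 2)) ≤
              SigmaDelta.singMin
                (SigmaDelta.invDiffPow m r * (Φ ω).submatrix id T)} := by
  set cA : ℝ := 1 / ((r + 1) * (4 * (r + 1)) ^ r) with hcA
  have hcA0 : 0 < cA := by positivity
  -- The term `1 / 2` pays for taking the floor in `l`. The other makes the claim vacuous when `L <
  -- 22`: then $k\le N\le e^{22}$, and the asserted probability is at most 0.
  set c₇ : ℝ := min (1 / 2) (Real.log 2 / (Real.exp 22 * 22)) with hc₇
  have hc₇0 : 0 < c₇ := lt_min (by norm_num) (by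
    have := Real.log_pos one_lt_two
    positivity)
  refine ⟨cA / 4000, 1, c₇, by positivity, one_pos, hc₇0, fun m j hj hm => ?_, ?_⟩
  · refine le_trans ?_ (SigmaDelta.const_mul_le_singVal_invDiffPow hj hm)
    rw [← hcA]
    gcongr
    linarith
  intro α hα0 hα1 m k N hm hk hkN lam hlam hlog Ω _ P _ Φ hΦ
  have hm0 : (0 : ℝ) < m := by exact_mod_cast hm
  have hk0 : (0 : ℝ) < k := by exact_mod_cast hk
  have hk1 : (1 : ℝ) ≤ k := by exact_mod_cast hk
  have hN1 : (1 : ℝ) ≤ N := by exact_mod_cast hk.trans hkN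
  have hlam0 : 0 < lam := by
    rw [hlam]
    positivity
  set L := lam ^ (1 - α) with hL
  have hL0 : 0 < L := Real.rpow_pos_of_pos hlam0 _
  have hkL : (m : ℝ) * lam ^ (-α) = k * L := by
    rw [hL, sub_eq_add_neg, Real.rpow_add hlam0, Real.rpow_one, ← mul_assoc]
    congr 1
    rw [hlam]
    field_simp
  have hNL : Real.log N ≤ L := by
    have hlogN : 0 ≤ Real.log N := Real.log_nonneg hN1
    calc Real.log N = (Real.log N ^ (1 / (1 - α))) ^ (1 - α) := by
          rw [← Real.rpow_mul hlogN, one_div_mul_cancel (by linarith), Real.rpow_one]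
      _ ≤ L := by
          rw [one_mul] at hlog
          exact Real.rpow_le_rpow (Real.rpow_nonneg hlogN _) hlog (by linarith)
  rw [mul_assoc, hkL]
  rcases lt_or_ge L 22 with hL22 | hL22
  · have hkexp : (k : ℝ) ≤ Real.exp 22 := by
      have h1 : (N : ℝ) ≤ Real.exp L := (Real.log_le_iff_le_exp (by linarith)).1 hNL
      have h2 : Real.exp L ≤ Real.exp 22 := Real.exp_le_exp.2 hL22.le
      have h3 : (k : ℝ) ≤ N := by exact_mod_cast hkN
      linarith
    have h1 : c₇ * (k * L) ≤ Real.log 2 := by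
      calc c₇ * (k * L) ≤ Real.log 2 / (Real.exp 22 * 22) * (Real.exp 22 * 22) := by
            gcongr
            exact min_le_right _ _
        _ = Real.log 2 := by field_simp
    have h2 : Real.exp (-Real.log 2) ≤ Real.exp (-(c₇ * (k * L))) :=
      Real.exp_le_exp.2 (by linarith)
    rw [Real.exp_neg, Real.exp_log two_pos] at h2
    exact le_trans (by linarith) measureReal_nonneg
  set l := ⌊k * L⌋₊ with hl
  have hkL22 : 22 ≤ k * L := by nlinarith
  have hl_le : (l : ℝ) ≤ k * L := Nat.floor_le (by linarith)
  have hl_gt : k * L < l + 1 := Nat.lt_floor_add_one _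
  have hl0 : (0 : ℝ) < l := by linarith
  have hlam1 : 1 ≤ lam := by
    by_contra! h
    have := Real.rpow_le_one hlam0.le h.le (by linarith : 0 ≤ 1 - α)
    linarith
  have hlm : l ≤ m := by
    have h1 : lam ^ (-α) ≤ 1 := Real.rpow_le_one_of_one_le_of_nonpos hlam1 (by linarith)
    have h2 : (l : ℝ) ≤ m := by nlinarith
    exact_mod_cast h2
  -- Since $l\le m\lambda^{-\alpha}$, one has $m/l\ge\lambda^\alpha$; the exponent `r` comes from
  -- $\sigma_l$ and the `-1/2` from $\sqrt{l/m}$.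
  have hthr : cA / 4000 * lam ^ (α * ((r : ℝ) - 1 / 2)) ≤
      SigmaDelta.singVal (SigmaDelta.invDiffPow m r) l * (1 / 4000 * √(l / m)) := by
    have h1 := SigmaDelta.const_mul_le_singVal_invDiffPow (r := r) (j := l) (m := m)
      (by exact_mod_cast hl0) hlm
    have h2 : lam ^ α ≤ (m : ℝ) / l := by
      rw [le_div_iff₀ hl0]
      calc lam ^ α * l ≤ lam ^ α * (m * lam ^ (-α)) := by
            rw [hkL]
            gcongr
        _ = m := by
            rw [Real.rpow_neg hlam0.le]
            have := (Real.rpow_pos_of_pos hlam0 α).ne'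
            field_simp
    have h3 := SigmaDelta.rpow_le_pow_mul_sqrt hr (Real.rpow_pos_of_pos hlam0 α) h2
    rw [one_div_div, ← Real.rpow_mul hlam0.le] at h3
    calc _ ≤ cA / 4000 * (((m : ℝ) / l) ^ r * √(l / m)) := by gcongr
      _ = cA * ((m : ℝ) / l) ^ r * (1 / 4000 * √(l / m)) := by ring
      _ ≤ _ := by gcongr
  calc 1 - 2 * Real.exp (-(c₇ * (k * L))) ≤ 1 - 2 * Real.exp (-(l : ℝ)) := by
        have h1 : c₇ * (k * L) ≤ 1 / 2 * (k * L) := by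
          gcongr
          exact min_le_left _ _
        have h2 : Real.exp (-(l : ℝ)) ≤ Real.exp (-(c₇ * (k * L))) :=
          Real.exp_le_exp.2 (by linarith)
        linarith
    _ ≤ _ := sub_le_sub_left
        (SigmaDelta.union_bound_le_exp hk hkN hL22 hNL (by linarith)) 1
    _ ≤ _ := SigmaDelta.prob_singMin_mul_submatrix_ge hm hΦ hk hlm (SigmaDelta.invDiffPow m r)
    _ ≤ _ := measureReal_mono fun ω hω T => hthr.trans (hω T)
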